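/- Let $G$ be an infinite group and let $A$ be a finite set. Equip $A^G$ with the prodiscrete topology and with the shift action $(gx)(h)=x(g^{-1}h)$. Let $X\subset A^G$ be a $G$-subshift, that is, a closed shift-invariant subset. For finite $F\subset G$, let $L_F(X)\subset A^F$ be the set of all patterns $p$ such that $(g^{-1}x)|_F=p$ for some $x\in X$ and $g\in G$. Suppose that $X$ is non-trivial, that is, $X$ has at least two points, and that $X$ is strongly irreducible: there is a finite set $K\subset G$ such that for all finite $S,T\subset G$ with $SK\cap T=\varnothing$ and all $p\in L_S(X)$, $q\in L_T(X)$ there is $x\in X$ with $x|_S=p$ and $x|_T=q$. Let $\operatorname{Aut}(X)$ be the group of all $G$-equivariant homeomorphisms $X\to X$ under composition. Then for every finite group $H$ there is an injective group homomorphism $H\to\operatorname{Aut}(X)$. -/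

import Mathlib

open scoped Pointwise

namespace SymbolicDynamics.FullShift.MulSubshift

variable {A : Type*} [TopologicalSpace A] {G : Type*} [Group G]

/-- The left shift action of `G` on a subshift `X ⊆ A ^ G`: `(g x)(h) = x (g⁻¹ h)`. -/
def act (X : MulSubshift A G) (g : G) (x : X.carrier) : X.carrier :=
  ⟨mulShift g⁻¹ x.1, X.mapsTo g⁻¹ x.2⟩

theorem act_apply (X : MulSubshift A G) (g : G) (x : X.carrier) (h : G) :
    (X.act g x).1 h = x.1 (g⁻¹ * h) := rfl

theorem act_one (X : MulSubshift A G) (x : X.carrier) : X.act 1 x = x := by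
  apply Subtype.ext
  funext h
  simp [act_apply]

theorem act_mul (X : MulSubshift A G) (g k : G) (x : X.carrier) :
    X.act (g * k) x = X.act g (X.act k x) := by
  apply Subtype.ext
  funext h
  simp [act_apply, mul_assoc]

/-- `L_F(X)`: the patterns `p ∈ A ^ F` that appear in some `x ∈ X`, that is,
`(g⁻¹ x)|_F = p` for some position `g`. -/
def language (X : MulSubshift A G) (F : Finset G) : Set (F → A) :=
  {p | ∃ (x : X.carrier) (g : G), F.restrict (X.act g⁻¹ x).1 = p}

/-- `X` is strongly irreducible: for some finite `K ⊆ G`, whenever `S, T ⊆ G` are finite with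
`S K ∩ T = ∅`, any `p ∈ L_S(X)` and `q ∈ L_T(X)` are seen simultaneously, on `S` and on `T`, in
some `x ∈ X`. -/
def IsStronglyIrreducible (X : MulSubshift A G) : Prop :=
  ∃ K : Finset G, ∀ S T : Finset G, Disjoint ((S : Set G) * (K : Set G)) (T : Set G) →
    ∀ p ∈ X.language S, ∀ q ∈ X.language T,
      ∃ x ∈ X.carrier, S.restrict x = p ∧ T.restrict x = q

/-- `Aut(X)`: the group, under composition, of all homeomorphisms `X → X` that commute with the
shift action. -/
def Aut (X : MulSubshift A G) : Subgroup (X.carrier ≃ₜ X.carrier) where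
  carrier := {φ | ∀ (g : G) (x : X.carrier), φ (X.act g x) = X.act g (φ x)}
  mul_mem' := by
    intro φ ψ hφ hψ g x
    change φ (ψ (X.act g x)) = X.act g (φ (ψ x))
    rw [hψ, hφ]
  one_mem' := fun _ _ => rfl
  inv_mem' := by
    intro φ hφ g x
    change φ.symm (X.act g x) = X.act g (φ.symm x)
    apply φ.injective
    rw [hφ, φ.apply_symm_apply, φ.apply_symm_apply]

end SymbolicDynamics.FullShift.MulSubshift

/-! A finite group acts on `X` by permuting patterns in a finite window `E`, the hole, wherever a
marker pattern is seen on a finite set `S` disjoint from `E`. This gives commuting-with-shift,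
invertible maps of `X` under two conditions.

The admissible fillings of the hole must not depend on what lies beyond the marker. For this,
`exists_hole` chooses a surrounding pattern leaving as few fillings as possible: prescribing more
outside `E` can then exclude none of them. Strong irreducibility still leaves as many fillings as
desired.

Distinct markers must not interfere: no hole may meet the hole or the support of another marker. For
this, `exists_marker` surrounds the hole by a region from which some pattern `w` is absent, and
fills the rest of the marker with a configuration in which `w` occurs everywhere, up to sparse
defects. A shift of intermediate size would put `w` where it cannot be; the defects rule out the
finitely many remaining shifts. Such a `w` exists because `X` is not minimal (`exists_free`).

The action of `G` on `X` need not be faithful, so markers are separated only up to the common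
periods of `X`. These form a finite group, and `E` is chosen invariant under it. -/

namespace SymbolicDynamics.FullShift.MulSubshift

/-! ### Gluing along infinite sets, and non-minimality. -/

section Gluing

variable {A : Type*} [TopologicalSpace A] {G : Type*} [Group G]

/-- A finite symmetric set `K ∋ 1` such that any two points of `X` can be glued along any two
(possibly infinite) sets `S`, `T` with `S K ∩ T = ∅`. -/
structure IsGluingSet (X : MulSubshift A G) (K : Set G) : Prop where
  finite : K.Finite
  one_mem : (1 : G) ∈ K
  inv_mem : ∀ k ∈ K, k⁻¹ ∈ K
  glue : ∀ S T : Set G, (∀ s ∈ S, ∀ k ∈ K, s * k ∉ T) → ∀ x ∈ X.carrier, ∀ y ∈ X.carrier,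
    ∃ z ∈ X.carrier, Set.EqOn z x S ∧ Set.EqOn z y T

theorem shift_mem (X : MulSubshift A G) {x : G → A} (hx : x ∈ X.carrier) (g : G) :
    (fun h => x (g * h)) ∈ X.carrier := X.mapsTo g hx

theorem isCompact_carrier [Finite A] (X : MulSubshift A G) : IsCompact X.carrier :=
  X.isClosed.isCompact

/-- Compactness of `X`: each constraint cuts out a closed set. -/
theorem exists_mem_of_finite_constraints [Finite A] [DiscreteTopology A] (X : MulSubshift A G)
    {ι : Type*} (pos : ι → G) (val : ι → A)
    (h : ∀ u : Finset ι, ∃ z ∈ X.carrier, ∀ i ∈ u, z (pos i) = val i) :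
    ∃ z ∈ X.carrier, ∀ i, z (pos i) = val i := by
  have := X.isCompact_carrier.inter_iInter_nonempty (fun i => {z : G → A | z (pos i) = val i})
    (fun i => isClosed_eq (continuous_apply _) continuous_const) (fun u => by
      obtain ⟨z, hz, hu⟩ := h u
      exact ⟨z, hz, by simpa using hu⟩)
  obtain ⟨z, hz, hu⟩ := this
  exact ⟨z, hz, by simpa using hu⟩

/-- A configuration belongs to `X` as soon as it agrees with a point of `X` on every finite set. -/
theorem mem_of_forall_finset [Finite A] [DiscreteTopology A] (X : MulSubshift A G) {x : G → A}
    (h : ∀ F : Finset G, ∃ z ∈ X.carrier, ∀ g ∈ F, z g = x g) : x ∈ X.carrier := by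
  obtain ⟨z, hz, hzx⟩ := X.exists_mem_of_finite_constraints id x h
  rwa [← show z = x from funext hzx]

/-- Enlarging the set of strong irreducibility only strengthens the separation hypothesis, so it may
be made symmetric and contain `1`. Compactness passes from finite to arbitrary `S` and `T`. -/
theorem exists_isGluingSet [Finite A] [DiscreteTopology A] (X : MulSubshift A G)
    (hSI : X.IsStronglyIrreducible) : ∃ K, X.IsGluingSet K := by
  classical
  obtain ⟨K₀, hK₀⟩ := hSI
  refine ⟨K₀ ∪ (K₀ : Set G)⁻¹ ∪ {1}, by simp, by simp, ?_, ?_⟩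
  · rintro k ((hk | hk) | hk)
    · exact Or.inl (Or.inr (by simpa using hk))
    · exact Or.inl (Or.inl (by simpa using hk))
    · exact Or.inr (by simpa using hk)
  · intro S T hST x hx y hy
    obtain ⟨z, hz, h⟩ := X.exists_mem_of_finite_constraints
      (Sum.elim (fun s : S => (s : G)) (fun t : T => (t : G)))
      (Sum.elim (fun s : S => x s) (fun t : T => y t)) (by
        intro u
        have hd : Disjoint (((u.toLeft.image Subtype.val : Finset G) : Set G) * (K₀ : Set G))
            ((u.toRight.image Subtype.val : Finset G) : Set G) := by
          rw [Set.disjoint_left]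
          rintro _ ⟨s, hs, k, hk, rfl⟩ ht
          simp only [Finset.coe_image, Set.mem_image, Finset.mem_coe] at hs ht
          obtain ⟨s, -, rfl⟩ := hs
          obtain ⟨t, -, ht⟩ := ht
          exact hST s s.2 k (Or.inl (Or.inl hk)) (ht ▸ t.2)
        obtain ⟨z, hz, h1, h2⟩ := hK₀ _ _ hd _ ⟨⟨x, hx⟩, 1, rfl⟩ _ ⟨⟨y, hy⟩, 1, rfl⟩
        refine ⟨z, hz, ?_⟩
        rintro (s | t) hi
        · have := congrFun h1 ⟨s, by simpa using hi⟩
          simpa [act_apply] using this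
        · have := congrFun h2 ⟨t, by simpa using hi⟩
          simpa [act_apply] using this)
    exact ⟨z, hz, fun s hs => h (Sum.inl ⟨s, hs⟩), fun t ht => h (Sum.inr ⟨t, ht⟩)⟩

namespace IsGluingSet

variable {X : MulSubshift A G} {K : Set G}

theorem glue_finset (hK : X.IsGluingSet K) (hX : X.carrier.Nonempty) {ι : Type*} (S : ι → Set G)
    (x : ι → G → A) (hx : ∀ i, x i ∈ X.carrier)
    (hS : ∀ i j, i ≠ j → ∀ s ∈ S i, ∀ k ∈ K, s * k ∉ S j) (I : Finset ι) :
    ∃ z ∈ X.carrier, ∀ i ∈ I, Set.EqOn z (x i) (S i) := by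
  classical
  induction I using Finset.induction_on with
  | empty => exact ⟨_, hX.some_mem, by simp⟩
  | insert i I hi ih =>
    obtain ⟨z, hz, h⟩ := ih
    obtain ⟨z', hz', h1, h2⟩ := hK.glue (S i) (⋃ j ∈ I, S j) (by
      intro s hs k hk hmem
      simp only [Set.mem_iUnion] at hmem
      obtain ⟨j, hj, hmem⟩ := hmem
      exact hS i j (by rintro rfl; exact hi hj) s hs k hk hmem) (x i) (hx i) z hz
    refine ⟨z', hz', fun j hj => ?_⟩
    rcases Finset.mem_insert.1 hj with rfl | hj
    · exact h1
    · exact fun s hs => (h2 (Set.mem_biUnion hj hs)).trans (h j hj hs)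

theorem glue_family [Finite A] [DiscreteTopology A] (hK : X.IsGluingSet K)
    (hX : X.carrier.Nonempty) {ι : Type*} (S : ι → Set G)
    (x : ι → G → A) (hx : ∀ i, x i ∈ X.carrier)
    (hS : ∀ i j, i ≠ j → ∀ s ∈ S i, ∀ k ∈ K, s * k ∉ S j) :
    ∃ z ∈ X.carrier, ∀ i, Set.EqOn z (x i) (S i) := by
  classical
  obtain ⟨z, hz, h⟩ := X.exists_mem_of_finite_constraints
    (fun p : (i : ι) × S i => (p.2 : G)) (fun p => x p.1 p.2) (by
      intro u
      obtain ⟨z, hz, h⟩ := hK.glue_finset hX S x hx hS (u.image Sigma.fst)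
      exact ⟨z, hz, fun p hp => h p.1 (Finset.mem_image_of_mem _ hp) p.2.2⟩)
  exact ⟨z, hz, fun i s hs => h ⟨i, s, hs⟩⟩

theorem exists_apply_one_ne (X : MulSubshift A G) (hX : X.carrier.Nontrivial) :
    ∃ x ∈ X.carrier, ∃ y ∈ X.carrier, x 1 ≠ y 1 := by
  obtain ⟨x, hx, y, hy, hne⟩ := hX
  obtain ⟨g, hg⟩ := Function.ne_iff.1 hne
  exact ⟨_, X.shift_mem hx g, _, X.shift_mem hy g, by simpa using hg⟩

theorem _root_.Set.Finite.exists_separated_finset [Infinite G] {D : Set G} (hD : D.Finite)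
    (n : ℕ) : ∃ V : Finset G, V.card = n ∧
      ∀ a ∈ V, ∀ b ∈ V, a ≠ b → a⁻¹ * b ∉ D := by
  classical
  induction n with
  | zero => exact ⟨∅, by simp⟩
  | succ n ih =>
    obtain ⟨V, hV, hsep⟩ := ih
    have hfin : ((V : Set G) ∪ (V : Set G) * D ∪ (V : Set G) * D⁻¹).Finite :=
      (V.finite_toSet.union (V.finite_toSet.mul hD)).union (V.finite_toSet.mul hD.inv)
    obtain ⟨b, hb⟩ := hfin.exists_notMem
    simp only [Set.mem_union, not_or] at hb
    refine ⟨insert b V, by rw [Finset.card_insert_of_notMem (by simpa using hb.1.1), hV], ?_⟩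
    intro a ha c hc hne hmem
    rcases Finset.mem_insert.1 ha with rfl | ha' <;> rcases Finset.mem_insert.1 hc with rfl | hc'
    · exact hne rfl
    · exact hb.2 ⟨c, hc', _, Set.inv_mem_inv.2 hmem, by simp⟩
    · exact hb.1.2 ⟨a, ha', _, hmem, by simp⟩
    · exact hsep a ha' c hc' hne hmem

/-- A point in which the pattern of `w` on `W` occurs in every translate of `W K W⁻¹`. -/
theorem exists_dense [Finite A] [DiscreteTopology A] (hK : X.IsGluingSet K) {w : G → A}
    (hw : w ∈ X.carrier) {W : Set G} (hW : W.Nonempty) :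
    ∃ x ∈ X.carrier, ∀ g, ∃ d ∈ W * K * W⁻¹, ∀ v ∈ W, x (g * d * v) = w v := by
  -- Copies of `w` are placed on the translates `n W`, `n ∈ N`. Separation of `N` allows them to be
  -- glued; maximality makes `N` meet every translate of `W K W⁻¹`.
  obtain ⟨N, hN⟩ := zorn_subset {N : Set G | ∀ a ∈ N, ∀ b ∈ N, a ≠ b → a⁻¹ * b ∉ W * K * W⁻¹} (by
    intro c hc hchain
    refine ⟨⋃₀ c, ?_, fun s hs => Set.subset_sUnion_of_mem hs⟩
    rintro a ⟨s, hs, has⟩ b ⟨t, ht, hbt⟩ hne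
    rcases hchain.total hs ht with h | h
    · exact hc ht a (h has) b hbt hne
    · exact hc hs a has b (h hbt) hne)
  have hsymm : ∀ d ∈ W * K * W⁻¹, d⁻¹ ∈ W * K * W⁻¹ := by
    rintro _ ⟨_, ⟨a, ha, k, hk, rfl⟩, b, hb, rfl⟩
    exact ⟨_, ⟨b⁻¹, hb, k⁻¹, hK.inv_mem k hk, rfl⟩, a⁻¹, by simpa using ha, by simp [mul_assoc]⟩
  have hone : (1 : G) ∈ W * K * W⁻¹ := by
    obtain ⟨a, ha⟩ := hW
    exact ⟨_, ⟨a, ha, 1, hK.one_mem, rfl⟩, a⁻¹, by simpa using ha, by simp⟩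
  obtain ⟨x, hx, hxN⟩ := hK.glue_family ⟨w, hw⟩ (fun n : N => {g | (n : G)⁻¹ * g ∈ W})
    (fun n g => w ((n : G)⁻¹ * g)) (fun n => X.shift_mem hw _) (by
      rintro ⟨a, ha⟩ ⟨b, hb⟩ hne s hs k hk ht
      refine hN.prop a ha b hb (by simpa using hne) ?_
      exact ⟨_, ⟨a⁻¹ * s, hs, k, hk, rfl⟩, (b⁻¹ * (s * k))⁻¹, by simpa using ht,
        by simp [mul_assoc]⟩)
  refine ⟨x, hx, fun g => ?_⟩
  obtain ⟨n, hn, hd⟩ : ∃ n ∈ N, g⁻¹ * n ∈ W * K * W⁻¹ := by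
    by_contra! hcon
    have hg : insert g N ⊆ N := hN.le_of_ge (by
      intro a ha b hb hne hmem
      rcases ha with rfl | ha <;> rcases hb with rfl | hb
      · exact hne rfl
      · exact hcon b hb hmem
      · exact hcon a ha (by simpa using hsymm _ hmem)
      · exact hN.prop a ha b hb hne hmem) (Set.subset_insert _ _)
    exact hcon g (hg (Set.mem_insert _ _)) (by simpa using hone)
  refine ⟨_, hd, fun v hv => ?_⟩
  have := hxN ⟨n, hn⟩ (x := n * v) (by simpa using hv)
  simpa using this

/-- Two symbols that occur in `X` can be chosen independently at the points of `V`. -/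
theorem two_pow_le_ncard_patterns [Finite A] [DiscreteTopology A] (hK : X.IsGluingSet K)
    (hX : X.carrier.Nontrivial) (V : Finset G) (hV : ∀ a ∈ V, ∀ b ∈ V, a ≠ b → a⁻¹ * b ∉ K) :
    2 ^ V.card ≤ ((fun (z : G → A) (v : V) => z v) '' X.carrier).ncard := by
  classical
  obtain ⟨x, hx, y, hy, hxy⟩ := exists_apply_one_ne X hX
  have key : ∀ b : V → Bool, ∃ z ∈ X.carrier, ∀ v : V, z v = bif b v then x 1 else y 1 := by
    intro b
    obtain ⟨z, hz, h⟩ := hK.glue_family hX.nonempty (fun v : V => {(v : G)})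
      (fun v g => (bif b v then x else y) ((v : G)⁻¹ * g))
      (fun v => X.shift_mem (by cases b v <;> simpa) _) (by
        rintro v v' hne s rfl k hk (h : v * k = v')
        exact hV v v.2 v' v'.2 (Subtype.coe_injective.ne hne) (by simpa [← h] using hk))
    refine ⟨z, hz, fun v => ?_⟩
    have := h v (x := v) rfl
    cases hb : b v <;> simpa [hb] using this
  choose z hz hzb using key
  have hinj : Function.Injective fun (b : V → Bool) (v : V) => z b v := by
    intro b c hbc
    funext v
    have := congrFun hbc v
    simp only [hzb] at this
    cases hb : b v <;> cases hc : c v <;> simp_all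
  have := Set.ncard_le_ncard (s := Set.range fun (b : V → Bool) (v : V) => z b v)
    (t := ((fun (z : G → A) (v : V) => z v) '' X.carrier))
    (by rintro _ ⟨b, rfl⟩; exact ⟨z b, hz b, rfl⟩) (Set.toFinite _)
  rwa [← Set.image_univ, Set.ncard_image_of_injective _ hinj, Set.ncard_univ, Nat.card_fun,
    Nat.card_eq_fintype_card, Fintype.card_bool, Nat.card_eq_fintype_card,
    Fintype.card_coe] at this

/-- A strongly irreducible subshift is not minimal: some pattern never occurs in some point. -/
theorem exists_free [Finite A] [DiscreteTopology A] [Infinite G] (hK : X.IsGluingSet K)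
    (hX : X.carrier.Nontrivial) : ∃ W : Set G, W.Finite ∧ W.Nonempty ∧
      ∃ w ∈ X.carrier, ∃ x ∈ X.carrier, ∀ g, ∃ v ∈ W, x (g * v) ≠ w v := by
  classical
  -- With `n` the size of `V`, the left side bounds the size of `D = V K V⁻¹`, and the right side
  -- bounds from below the number of patterns on `V`.
  obtain ⟨n, hn1, hn⟩ : ∃ n : ℕ, 1 ≤ n ∧ n * Nat.card K * n < 2 ^ n := by
    have h := (tendsto_pow_const_div_const_pow_of_one_lt 2 (r := (2 : ℝ)) (by norm_num))
    have h' := (h.mul_const (Nat.card K : ℝ)).eventually_lt_const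
      (show (0 : ℝ) * Nat.card K < 1 by norm_num)
    obtain ⟨n, hn, hn1⟩ := (h'.and (Filter.eventually_ge_atTop 1)).exists
    refine ⟨n, hn1, ?_⟩
    rw [div_mul_eq_mul_div, div_lt_one (by positivity)] at hn
    have : (n ^ 2 * Nat.card K : ℕ) < 2 ^ n := by exact_mod_cast hn
    linarith [show n * Nat.card K * n = n ^ 2 * Nat.card K by ring]
  obtain ⟨V, hV, hsep⟩ := hK.finite.exists_separated_finset n
  have hVne : (V : Set G).Nonempty := by
    rw [Finset.coe_nonempty, ← Finset.card_pos]; omega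
  obtain ⟨y, hy⟩ := hX.nonempty
  set D : Set G := V * K * (V : Set G)⁻¹ with hD
  have hDfin : D.Finite := (V.finite_toSet.mul hK.finite).mul V.finite_toSet.inv
  have hDcard : D.ncard < 2 ^ n := by
    refine lt_of_le_of_lt ?_ hn
    have h1 := Set.natCard_mul_le (s := (V : Set G) * K) (t := (V : Set G)⁻¹)
    have h2 := Set.natCard_mul_le (s := (V : Set G)) (t := K)
    have h3 : Nat.card ((V : Set G)⁻¹ : Set G) = n := by simp [hV]
    have h4 : Nat.card (V : Set G) = n := by simp [hV]
    rw [h3] at h1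
    rw [h4] at h2
    exact h1.trans (Nat.mul_le_mul_right _ h2)
  -- Some pattern `u` on `V` is not seen in `y` at any position of `D`. In a point where `u` is seen
  -- in every translate of `D`, the pattern of `y` on `D V` never occurs.
  obtain ⟨_, ⟨u, hu, rfl⟩, hnot⟩ := Set.exists_mem_notMem_of_ncard_lt_ncard
    (s := (fun (d : G) (v : V) => y (d * v)) '' D)
    (((Set.ncard_image_le hDfin).trans_lt hDcard).trans_le
      (hV ▸ hK.two_pow_le_ncard_patterns hX V hsep)) (hDfin.image _)
  obtain ⟨x, hx, hxu⟩ := hK.exists_dense hu hVne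
  refine ⟨D * V, hDfin.mul V.finite_toSet, ?_, y, hy, x, hx, fun g => ?_⟩
  · obtain ⟨d, hd, -⟩ := hxu 1
    exact Set.Nonempty.mul ⟨d, hd⟩ hVne
  · obtain ⟨d, hd, hdu⟩ := hxu g
    by_contra! hcon
    refine hnot ⟨d, hd, ?_⟩
    funext v
    change y (d * v) = u v
    rw [← hcon _ (Set.mul_mem_mul hd v.2), ← mul_assoc]
    exact hdu v v.2

end IsGluingSet

end Gluing

end SymbolicDynamics.FullShift.MulSubshift

namespace SymbolicDynamics.FullShift.MulSubshift

/-! ### Common periods, and holes with freely exchangeable fillings. -/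

section Periods

variable {A : Type*} [TopologicalSpace A] {G : Type*} [Group G]

/-- The kernel of the shift action on `X`: the common periods of all points of `X`. -/
def periods (X : MulSubshift A G) : Subgroup G where
  carrier := {t | ∀ x ∈ X.carrier, ∀ h, x (t * h) = x h}
  one_mem' := by simp
  mul_mem' := fun {a b} ha hb x hx h => by rw [mul_assoc, ha x hx, hb x hx]
  inv_mem' := fun {a} ha x hx h => by rw [← ha x hx (a⁻¹ * h), mul_inv_cancel_left]

theorem apply_mul_of_mem_periods {X : MulSubshift A G} {t : G} (ht : t ∈ X.periods) {x : G → A}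
    (hx : x ∈ X.carrier) (h : G) : x (t * h) = x h := ht x hx h

open Classical in
/-- The configuration `y` with its values on `E` replaced by `u`. -/
noncomputable def patch (E : Set G) (u : E → A) (y : G → A) : G → A :=
  fun g => if h : g ∈ E then u ⟨g, h⟩ else y g

omit [TopologicalSpace A] [Group G] in
theorem patch_of_mem {E : Set G} (u : E → A) (y : G → A) {g : G} (h : g ∈ E) :
    patch E u y g = u ⟨g, h⟩ := dif_pos h

omit [TopologicalSpace A] [Group G] in
theorem patch_of_notMem {E : Set G} (u : E → A) (y : G → A) {g : G} (h : g ∉ E) :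
    patch E u y g = y g := dif_neg h

namespace IsGluingSet

variable {X : MulSubshift A G} {K : Set G}

theorem exists_apply_ne (hK : X.IsGluingSet K) (hX : X.carrier.Nontrivial) {k : G} (hk : k ∉ K) :
    ∃ x ∈ X.carrier, x k ≠ x 1 := by
  obtain ⟨x, hx, y, hy, hxy⟩ := exists_apply_one_ne X hX
  obtain ⟨z, hz, h1, h2⟩ := hK.glue {1} {k} (by rintro _ rfl l hl rfl; exact hk (by simpa using hl))
    x hx _ (X.shift_mem hy k⁻¹)
  refine ⟨z, hz, ?_⟩
  rw [h1 rfl, h2 rfl]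
  simpa using hxy.symm

/-- In particular there are finitely many periods, so a finite hole can be made invariant under
them. -/
theorem periods_subset (hK : X.IsGluingSet K) (hX : X.carrier.Nontrivial) :
    (X.periods : Set G) ⊆ K := by
  intro t ht
  by_contra htK
  obtain ⟨x, hx, h⟩ := hK.exists_apply_ne hX htK
  exact h (by simpa using apply_mul_of_mem_periods ht hx 1)

/-- If `h⁻¹ t h ∉ K`, then gluing distinguishes `t h` from `h`. So if the set were finite,
infinitely many `h` would give one and the same conjugate `h⁻¹ t h`. The quotients `h h₁⁻¹` of these
commute with `t`, and translating by them a single place where `t` fails to be a period gives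
infinitely many such places. -/
theorem infinite_setOf_apply_ne [Infinite G] (hK : X.IsGluingSet K) (hX : X.carrier.Nontrivial)
    {t : G} (ht : t ∉ X.periods) : {h | ∃ x ∈ X.carrier, x (t * h) ≠ x h}.Infinite := by
  intro hfin
  set B := {h | ∃ x ∈ X.carrier, x (t * h) ≠ x h} with hB
  have hsub : Bᶜ ⊆ ⋃ k ∈ K, {h | h⁻¹ * t * h = k} := by
    intro h hh
    refine Set.mem_biUnion (x := h⁻¹ * t * h) ?_ rfl
    by_contra hk
    obtain ⟨x, hx, hne⟩ := hK.exists_apply_ne hX hk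
    exact hh ⟨_, X.shift_mem hx h⁻¹, by simpa [mul_assoc] using hne⟩
  obtain ⟨k, -, hk⟩ : ∃ k ∈ K, {h | h⁻¹ * t * h = k}.Infinite := by
    by_contra! hcon
    exact hfin.infinite_compl ((hK.finite.biUnion hcon).subset hsub)
  obtain ⟨h₁, hh₁⟩ := hk.nonempty
  have hne : ¬ ∀ x ∈ X.carrier, ∀ h, x (t * h) = x h := ht
  push Not at hne
  obtain ⟨x, hx, h₀, hh₀⟩ := hne
  refine (hk.image (f := fun h => h * h₁⁻¹ * h₀) fun a _ b _ hab => by simpa using hab)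
    (hfin.subset ?_)
  rintro _ ⟨h, hh, rfl⟩
  refine ⟨_, X.shift_mem hx (h * h₁⁻¹)⁻¹, ?_⟩
  have hcomm : (h * h₁⁻¹)⁻¹ * (t * (h * h₁⁻¹ * h₀)) = t * h₀ := by
    have e : h⁻¹ * t * h = h₁⁻¹ * t * h₁ := Eq.trans hh (Eq.symm hh₁)
    calc _ = h₁ * (h⁻¹ * t * h) * h₁⁻¹ * h₀ := by group
      _ = t * h₀ := by rw [e]; group
  have e2 : (h * h₁⁻¹)⁻¹ * (h * h₁⁻¹ * h₀) = h₀ := by group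
  change x ((h * h₁⁻¹)⁻¹ * (t * (h * h₁⁻¹ * h₀))) ≠ x ((h * h₁⁻¹)⁻¹ * (h * h₁⁻¹ * h₀))
  rwa [hcomm, e2]

/-- There are a finite set `E` and a pattern on a finite set `S` disjoint from `E` such that around
any occurrence of this pattern, at least `n` patterns on `E` can be freely exchanged. -/
theorem exists_hole [Finite A] [DiscreteTopology A] [Infinite G] (hK : X.IsGluingSet K)
    (hX : X.carrier.Nontrivial) (n : ℕ) :
    ∃ E S : Set G, E.Finite ∧ S.Finite ∧ Disjoint E S ∧
      (∀ t ∈ X.periods, ∀ e ∈ E, t * e ∈ E) ∧ ∃ x ∈ X.carrier, ∃ C : Set (E → A), n ≤ C.ncard ∧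
        ∀ y ∈ X.carrier, Set.EqOn y x S → ∀ u, patch E u y ∈ X.carrier ↔ u ∈ C := by
  classical
  obtain ⟨V, hV, hsep⟩ := hK.finite.exists_separated_finset n
  have hM : (X.periods : Set G).Finite := hK.finite.subset (hK.periods_subset hX)
  -- The factor `K` lets patterns on `V` be glued to anything outside `E`; the factor `X.periods`
  -- makes `E` invariant under periods.
  obtain ⟨E, hE⟩ : ∃ E, E = (X.periods : Set G) * ((V : Set G) * K) := ⟨_, rfl⟩
  have hEfin : E.Finite := hE ▸ hM.mul (V.finite_toSet.mul hK.finite)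
  have hVK : ∀ v ∈ V, ∀ k ∈ K, v * k ∈ E := fun v hv k hk =>
    hE ▸ ⟨1, X.periods.one_mem, _, Set.mul_mem_mul hv hk, one_mul _⟩
  have hVE : ∀ v ∈ V, v ∈ E := fun v hv => by simpa using hVK v hv 1 hK.one_mem
  have hEinv : ∀ t ∈ X.periods, ∀ e ∈ E, t * e ∈ E := by
    rw [hE]
    rintro t ht _ ⟨m, hm, a, ha, rfl⟩
    exact ⟨t * m, X.periods.mul_mem ht hm, a, ha, mul_assoc _ _ _⟩
  have : Finite E := hEfin
  let I := X.carrier × {S : Set G // S.Finite ∧ Disjoint E S}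
  let L : (G → A) → Set G → Set (E → A) := fun y S =>
    (fun (z : G → A) (e : E) => z e) '' {z ∈ X.carrier | Set.EqOn z y S}
  have : Nonempty I := ⟨⟨⟨_, hX.nonempty.some_mem⟩, ∅, by simp⟩⟩
  -- A finite pattern outside `E` that leaves the fewest possible fillings of `E`.
  obtain ⟨⟨⟨x, hx⟩, S, hS, hES⟩, hmin⟩ : ∃ p : I, ∀ q : I,
      (L p.1 p.2).ncard ≤ (L q.1 q.2).ncard :=
    ⟨Function.argmin fun p : I => (L p.1 p.2).ncard,
      fun q => Function.argmin_le (fun p : I => (L p.1 p.2).ncard) q⟩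
  refine ⟨E, S, hEfin, hS, hES, hEinv, x, hx, L x S, ?_, fun y hy hyx u => ⟨fun hu => ?_, ?_⟩⟩
  · calc n ≤ 2 ^ n := Nat.lt_two_pow_self.le
      _ ≤ _ := hV ▸ hK.two_pow_le_ncard_patterns hX V hsep
      _ ≤ ((fun (u : E → A) (v : V) => u ⟨v, hVE v v.2⟩) '' L x S).ncard := by
        refine Set.ncard_le_ncard ?_ (Set.toFinite _)
        rintro _ ⟨z, hz, rfl⟩
        obtain ⟨z', hz', h1, h2⟩ := hK.glue V S
          (fun v hv k hk h => Set.disjoint_left.1 hES (hVK v hv k hk) h) z hz x hx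
        exact ⟨_, ⟨z', ⟨hz', h2⟩, rfl⟩, funext fun v => h1 v.2⟩
      _ ≤ _ := Set.ncard_image_le (Set.toFinite _)
  · refine ⟨_, ⟨hu, fun s hs => ?_⟩, funext fun e => patch_of_mem u y e.2⟩
    rw [patch_of_notMem u y (Set.disjoint_right.1 hES hs), hyx hs]
  · intro hu
    refine X.mem_of_forall_finset fun F => ?_
    have hdisj : Disjoint E (S ∪ ((F : Set G) \ E)) := hES.union_right Set.disjoint_sdiff_right
    have hle : L y (S ∪ ((F : Set G) \ E)) ⊆ L x S := by
      rintro _ ⟨z, ⟨hz, hzy⟩, rfl⟩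
      exact ⟨z, ⟨hz, fun s hs => (hzy (Or.inl hs)).trans (hyx hs)⟩, rfl⟩
    -- By minimality, also fixing `y` on `F \ E` excludes no filling in `L x S`.
    have heq := Set.eq_of_subset_of_ncard_le hle
      (hmin ⟨⟨y, hy⟩, _, hS.union (F.finite_toSet.subset Set.sdiff_subset), hdisj⟩) (Set.toFinite _)
    rw [← heq] at hu
    obtain ⟨z, ⟨hz, hzy⟩, rfl⟩ := hu
    refine ⟨z, hz, fun g hg => ?_⟩
    by_cases hgE : g ∈ E
    · rw [patch_of_mem _ _ hgE]
    · rw [patch_of_notMem _ _ hgE]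
      exact hzy (Or.inr ⟨hg, hgE⟩)

end IsGluingSet

end Periods

end SymbolicDynamics.FullShift.MulSubshift

namespace SymbolicDynamics.FullShift.MulSubshift

/-! ### Construction of a marker without harmful self-overlaps. -/

section Marker

variable {A : Type*} [TopologicalSpace A] {G : Type*} [Group G]

/-- A finite set each of whose translates contains a translate of `D` avoiding any given `m`
elements. -/
theorem _root_.Set.Finite.exists_avoiding_translates [Infinite G] {D : Set G} (hD : D.Finite)
    (m : ℕ) : ∃ Y : Set G, Y.Finite ∧ 1 ∈ Y ∧ ∀ (g : G) (B : Set G), B.Finite → B.ncard ≤ m →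
      ∃ c, ∀ a ∈ D, c * a ∈ Y ∧ g * (c * a) ∉ B := by
  classical
  -- The `m + 1` translates `c D`, `c ∈ V`, are disjoint, so `m` elements cannot meet them all.
  obtain ⟨V, hV, hsep⟩ := (hD.mul hD.inv).exists_separated_finset (m + 1)
  refine ⟨V * D ∪ {1}, (V.finite_toSet.mul hD).union (Set.finite_singleton _), Or.inr rfl,
    fun g B hB hcard => ?_⟩
  by_contra! hcon
  have hbad : ∀ c ∈ V, ∃ b ∈ B, ∃ a ∈ D, g * (c * a) = b := fun c hc => by
    obtain ⟨a, ha, h⟩ := hcon c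
    exact ⟨_, h (Or.inl (Set.mul_mem_mul hc ha)), a, ha, rfl⟩
  choose! f hfB hf using hbad
  have hle : V.card ≤ hB.toFinset.card := by
    refine Finset.card_le_card_of_injOn f (fun c hc => by simpa using hfB c hc) ?_
    intro c hc c' hc' hcc
    by_contra hne
    obtain ⟨a, ha, h⟩ := hf c hc
    obtain ⟨a', ha', h'⟩ := hf c' hc'
    refine hsep c hc c' hc' hne ⟨a, ha, a'⁻¹, by simpa using ha', ?_⟩
    have : c * a = c' * a' := mul_left_cancel (h.trans (hcc.trans h'.symm))
    change a * a'⁻¹ = _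
    rw [eq_inv_mul_iff_mul_eq, ← mul_assoc, this, mul_inv_cancel_right]
  rw [← Set.ncard_eq_toFinset_card B hB] at hle
  omega

namespace IsGluingSet

variable {X : MulSubshift A G} {K : Set G}

/-- A point can be modified sparsely so as to break a given finite set of translations. -/
theorem exists_sparse_modification [Infinite G] (hK : X.IsGluingSet K)
    (hX : X.carrier.Nontrivial) {x : G → A} (hx : x ∈ X.carrier) {Y Z : Set G} (hY : Y.Finite)
    (hZ : Z.Finite) (Q : Finset G) (hQ : ∀ t ∈ Q, t ∉ X.periods) :
    ∃ U : Set G, U.Finite ∧ ∃ y ∈ X.carrier, (∀ g, g ∉ U → y g = x g) ∧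
      (∀ t ∈ Q, ∃ h, h ∈ U ∧ h ∉ Z ∧ t * h ∈ U ∧ t * h ∉ Z ∧ y (t * h) ≠ y h) ∧
      ∀ g, ∃ B : Set G, B.Finite ∧ B.ncard ≤ 2 * K.ncard ∧
        ∀ a ∈ Y, g * a ∉ B → y (g * a) = x (g * a) := by
  classical
  induction Q using Finset.induction_on with
  | empty => exact ⟨∅, Set.finite_empty, x, hx, by simp, by simp, fun g => ⟨∅, by simp⟩⟩
  | insert t Q htQ ih =>
    obtain ⟨U, hU, y, hy, hyx, hyQ, hysp⟩ := ih fun t ht => hQ t (Finset.mem_insert_of_mem ht)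
    have ht := hQ t (Finset.mem_insert_self _ _)
    have hN : (Z ∪ U * K⁻¹ ∪ U * Y⁻¹ * Y * K⁻¹).Finite :=
      (hZ.union (hU.mul hK.finite.inv)).union (((hU.mul hY.inv).mul hY).mul hK.finite.inv)
    -- The new defect lies in `P K`, where `P = {h, t h}`. The choice of `h` keeps `P` out of `Z`,
    -- keeps `P K` off the old defects `U`, and ensures that no translate of `Y` meets both `P K`
    -- and `U`. Hence each translate sees the defects of one step only, at most `2 |K|` elements.
    obtain ⟨h, ⟨z, hz, hzh⟩, hh⟩ := ((hK.infinite_setOf_apply_ne hX ht).sdiff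
      (hN.union (hN.image (t⁻¹ * ·)))).nonempty
    have hP : ∀ p ∈ ({h, t * h} : Set G), p ∉ Z ∪ U * K⁻¹ ∪ U * Y⁻¹ * Y * K⁻¹ := by
      rintro p (rfl | rfl) hp
      · exact hh (Or.inl hp)
      · exact hh (Or.inr ⟨_, hp, by simp⟩)
    obtain ⟨P, hPdef⟩ : ∃ P : Set G, P = {h, t * h} := ⟨_, rfl⟩
    rw [← hPdef] at hP
    have hhP : h ∈ P := by simp [hPdef]
    have hthP : t * h ∈ P := by simp [hPdef]
    have hPK : P ⊆ P * K := fun p hp => ⟨p, hp, 1, hK.one_mem, mul_one p⟩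
    have hPfin : (P * K).Finite := by rw [hPdef]; exact (Set.toFinite _).mul hK.finite
    have hPcard : (P * K).ncard ≤ 2 * K.ncard := by
      refine (Set.natCard_mul_le (s := P) (t := K)).trans (Nat.mul_le_mul_right _ ?_)
      rw [hPdef]
      exact (Set.ncard_insert_le _ _).trans (by simp)
    obtain ⟨y', hy', h1, h2⟩ := hK.glue P (P * K)ᶜ
      (fun p hp k hk hn => hn (Set.mul_mem_mul hp hk)) z hz y hy
    have hUP : ∀ u ∈ U, u ∉ P * K := by
      rintro _ hu ⟨p, hp, k, hk, rfl⟩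
      exact hP p hp (Or.inl (Or.inr ⟨_, hu, k⁻¹, by simpa using hk, by simp⟩))
    refine ⟨U ∪ P * K, hU.union hPfin, y', hy', ?_, ?_, fun g => ?_⟩
    · intro g hg
      rw [h2 fun hn => hg (Or.inr hn), hyx g fun hn => hg (Or.inl hn)]
    · intro s hs
      rcases Finset.mem_insert.1 hs with rfl | hs
      · refine ⟨h, Or.inr (hPK hhP), fun hn => hP _ hhP (Or.inl (Or.inl hn)), Or.inr (hPK hthP),
          fun hn => hP _ hthP (Or.inl (Or.inl hn)), ?_⟩
        rwa [h1 hthP, h1 hhP]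
      · obtain ⟨h', ha, hb, hc, hd, he⟩ := hyQ s hs
        refine ⟨h', Or.inl ha, hb, Or.inl hc, hd, ?_⟩
        rwa [h2 (hUP _ hc), h2 (hUP _ ha)]
    · by_cases hg : ∃ a ∈ Y, g * a ∈ P * K
      · refine ⟨P * K, hPfin, hPcard, fun b hb hgb => ?_⟩
        obtain ⟨a, ha, p, hp, k, hk, hpk⟩ := hg
        rw [h2 hgb]
        refine hyx _ fun hn => hP p hp (Or.inr ⟨g * a, ⟨g * b * b⁻¹, ⟨_, hn, b⁻¹, by simpa using hb,
          rfl⟩, a, ha, by simp⟩, k⁻¹, by simpa using hk, ?_⟩)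
        change g * a * k⁻¹ = p
        rw [← hpk]
        simp
      · push Not at hg
        obtain ⟨B, hB, hBc, hBg⟩ := hysp g
        exact ⟨B, hB, hBc, fun a ha hn => (h2 (hg a ha)).trans (hBg a ha hn)⟩

/-- Any pattern can be extended to a marker: a pattern on a finite set `S`, disjoint from the
given finite set `E`, such that around two different occurrences in one configuration, the
translate of `E` at one occurrence does not meet the translate of `S ∪ E` at the other. -/
theorem exists_marker [Finite A] [DiscreteTopology A] [Infinite G] (hK : X.IsGluingSet K)
    (hX : X.carrier.Nontrivial) {E S₀ : Set G} (hE : E.Finite) (hS₀ : S₀.Finite)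
    (hES₀ : Disjoint E S₀) {x₀ : G → A} (hx₀ : x₀ ∈ X.carrier) :
    ∃ S : Set G, S.Finite ∧ S₀ ⊆ S ∧ Disjoint E S ∧ ∃ q ∈ X.carrier, Set.EqOn q x₀ S₀ ∧
      ∀ (y : G → A) (t : G), (∀ s ∈ S, y s = q s) → (∀ s ∈ S, y (t * s) = q s) →
        t ∉ X.periods → ∀ e ∈ E, t * e ∉ E ∪ S := by
  classical
  obtain ⟨W, hW, hWne, w, hw, xf, hxf, hfree⟩ := hK.exists_free hX
  obtain ⟨xd, hxd, hdense⟩ := hK.exists_dense hw hWne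
  set D : Set G := W * K * W⁻¹ with hDdef
  have hD : D.Finite := (hW.mul hK.finite).mul hW.inv
  obtain ⟨B₀, hB₀def⟩ : ∃ B₀, B₀ = (E ∪ S₀) * K := ⟨_, rfl⟩
  have hB₀ : B₀.Finite := hB₀def ▸ (hE.union hS₀).mul hK.finite
  -- Each translate of `Y` has room for an occurrence of `w` that avoids both the defects it sees
  -- (at most `2 |K|`) and a translate of `B₀`.
  obtain ⟨Y, hY, hY1, hYav⟩ := (hD.mul hW).exists_avoiding_translates (2 * K.ncard + B₀.ncard)
  obtain ⟨Γ, hΓdef⟩ : ∃ Γ, Γ = E * Y⁻¹ * Y := ⟨_, rfl⟩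
  have hΓ : Γ.Finite := hΓdef ▸ (hE.mul hY.inv).mul hY
  obtain ⟨Z, hZdef⟩ : ∃ Z, Z = (E ∪ S₀ ∪ Γ) * K := ⟨_, rfl⟩
  have hZ : Z.Finite := hZdef ▸ ((hE.union hS₀).union hΓ).mul hK.finite
  have hsubZ : E ∪ S₀ ∪ Γ ⊆ Z := fun g hg => hZdef ▸ ⟨g, hg, 1, hK.one_mem, mul_one g⟩
  have hsubB₀ : E ∪ S₀ ⊆ B₀ := fun g hg => hB₀def ▸ ⟨g, hg, 1, hK.one_mem, mul_one g⟩
  -- These are the shifts too small for the comparison of `w`-dense and `w`-free regions; the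
  -- defects exclude them.
  have hQfin : ((Z * Y⁻¹ * Y * E⁻¹) \ X.periods).Finite :=
    ((((hZ.mul hY.inv).mul hY).mul hE.inv)).subset Set.sdiff_subset
  obtain ⟨U, hU, x₁, hx₁, -, hpair, hsparse⟩ := hK.exists_sparse_modification hX hxd hY hZ
    hQfin.toFinset (fun t ht => (hQfin.mem_toFinset.1 ht).2)
  obtain ⟨x₂, hx₂, h21, h22⟩ := hK.glue (E ∪ S₀) B₀ᶜ
    (fun s hs k hk hn => hn (hB₀def ▸ Set.mul_mem_mul hs hk)) x₀ hx₀ xf hxf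
  -- From the inside out: `x₀` on `E ∪ S₀`, then on `Γ \ B₀` the point `xf` without `w`, and outside
  -- `Z` the point `x₁`, which is dense in `w` up to defects.
  obtain ⟨q, hq, hq1, hq2⟩ := hK.glue (E ∪ S₀ ∪ Γ) Zᶜ
    (fun s hs k hk hn => hn (hZdef ▸ Set.mul_mem_mul hs hk)) x₂ hx₂ x₁ hx₁
  obtain ⟨Ω, hΩdef⟩ : ∃ Ω, Ω = (Z ∪ U) * Y := ⟨_, rfl⟩
  have hsubΩ : Z ∪ U ⊆ Ω := fun g hg => hΩdef ▸ ⟨g, hg, 1, hY1, mul_one g⟩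
  have hEZ : E ⊆ Z := fun e he => hsubZ (Or.inl (Or.inl he))
  refine ⟨Ω \ E, (hΩdef ▸ (hZ.union hU).mul hY : Ω.Finite).subset Set.sdiff_subset,
    fun s hs => ⟨hsubΩ (Or.inl (hsubZ (Or.inl (Or.inr hs)))), Set.disjoint_right.1 hES₀ hs⟩,
    Set.disjoint_sdiff_right, q, hq, fun s hs => ?_, ?_⟩
  · rw [hq1 (Or.inl (Or.inr hs)), h21 (Or.inr hs)]
  intro y t hy hyt ht e he hmem
  have hΩ : t * e ∈ Ω := by
    rcases hmem with h | h
    · exact hsubΩ (Or.inl (hEZ h))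
    · exact h.1
  rw [hΩdef] at hΩ
  obtain ⟨f, hf, b, hb, hfb⟩ := hΩ
  change f * b = t * e at hfb
  have hin : ∀ a ∈ Y, f * a ∈ Ω := fun a ha => hΩdef ▸ Set.mul_mem_mul hf ha
  -- For a small shift, some `h` and `t h` both lie in `S` and outside `Z`; the two occurrences
  -- force `x₁ (t * h) = x₁ h`, contrary to the choice of the defects.
  by_cases htQ : t ∈ Z * Y⁻¹ * Y * E⁻¹
  · obtain ⟨h, ha, hb, hc, hd, hne⟩ := hpair t (by simpa using ⟨htQ, ht⟩)
    have e1 := hy (t * h) ⟨hsubΩ (Or.inr hc), fun hn => hd (hEZ hn)⟩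
    have e2 := hyt h ⟨hsubΩ (Or.inr ha), fun hn => hb (hEZ hn)⟩
    rw [hq2 hd] at e1
    rw [hq2 hb] at e2
    exact hne (e1.symm.trans e2)
  -- Otherwise `f Y` misses `Z`, so the first occurrence shows there a copy of `w` free of defects.
  -- Seen from the second occurrence, this copy lies in `Γ \ B₀`, where `q` agrees with `xf` and `w`
  -- cannot occur.
  · have hfZ : ∀ a ∈ Y, f * a ∉ Z := fun a ha hn => htQ ⟨f * a * a⁻¹ * b,
      ⟨_, ⟨_, hn, a⁻¹, by simpa using ha, rfl⟩, b, hb, rfl⟩, e⁻¹, by simpa using he, by simp [hfb]⟩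
    obtain ⟨B, hB, hBc, hBx⟩ := hsparse f
    obtain ⟨c, hc⟩ := hYav f (B ∪ (t * ·) '' B₀) (hB.union (hB₀.image _))
      ((Set.ncard_union_le _ _).trans (add_le_add hBc (Set.ncard_image_le hB₀)))
    obtain ⟨d, hd, hdw⟩ := hdense (f * c)
    obtain ⟨v, hv, hne⟩ := hfree (e * b⁻¹ * c * d)
    obtain ⟨haY, haB⟩ := hc _ (Set.mul_mem_mul hd hv)
    refine hne ?_
    have hts : f * (c * (d * v)) = t * (e * b⁻¹ * (c * (d * v))) := by
      calc f * (c * (d * v)) = f * b * b⁻¹ * (c * (d * v)) := by simp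
        _ = _ := by rw [hfb]; simp [mul_assoc]
    have hsΓ : e * b⁻¹ * (c * (d * v)) ∈ Γ :=
      hΓdef ▸ Set.mul_mem_mul (Set.mul_mem_mul he (by simpa using hb)) haY
    have hsB : e * b⁻¹ * (c * (d * v)) ∉ B₀ := fun hn => haB (Or.inr ⟨_, hn, hts.symm⟩)
    have e1 := hy _ ⟨hin _ haY, fun hn => hfZ _ haY (hEZ hn)⟩
    rw [hq2 (hfZ _ haY), hBx _ haY fun hn => haB (Or.inl hn)] at e1
    have e2 := hyt (e * b⁻¹ * (c * (d * v)))
      ⟨hsubΩ (Or.inl (hsubZ (Or.inr hsΓ))), fun hn => hsB (hsubB₀ (Or.inl hn))⟩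
    rw [hq1 (Or.inr hsΓ), h22 hsB, ← hts, e1] at e2
    have e3 := hdw v hv
    simp only [mul_assoc] at e2 e3 ⊢
    rw [← e2, e3]

end IsGluingSet

end Marker

end SymbolicDynamics.FullShift.MulSubshift

namespace SymbolicDynamics.FullShift.MulSubshift

/-! ### Automorphisms that exchange the fillings of marked holes. -/

section Exchange

variable {A : Type*} [TopologicalSpace A] {G : Type*} [Group G]

/-- The positions at which the pattern of `q` on `S` occurs in `x`. -/
def occurrences (S : Set G) (q x : G → A) : Set G := {g | ∀ s ∈ S, x (g * s) = q s}

/-- The pattern of `q` on `S` is a marker for the exchange of the patterns in `C` on `E`. -/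
structure IsMarker (X : MulSubshift A G) (E S : Set G) (q : G → A) (C : Set (E → A)) : Prop where
  finite_hole : E.Finite
  finite_support : S.Finite
  disjoint : Disjoint E S
  periods_mul_mem : ∀ t ∈ X.periods, ∀ e ∈ E, t * e ∈ E
  patch_mem : ∀ y ∈ X.carrier, Set.EqOn y q S → ∀ u, patch E u y ∈ X.carrier ↔ u ∈ C
  separated : ∀ (y : G → A) (t : G), (∀ s ∈ S, y s = q s) → (∀ s ∈ S, y (t * s) = q s) →
    t ∉ X.periods → ∀ e ∈ E, t * e ∉ E ∪ S

open Classical in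
/-- The configuration `x` with the pattern on `g E` modified by `σ`, at every occurrence `g` of the
pattern of `q` on `S`. -/
noncomputable def exchange {E : Set G} (S : Set G) (q : G → A) (σ : (E → A) → E → A)
    (x : G → A) : G → A := fun k =>
  if h : ∃ g, g ∈ occurrences S q x ∧ g⁻¹ * k ∈ E then
    σ (fun e => x (h.choose * e)) ⟨_, h.choose_spec.2⟩
  else x k

omit [TopologicalSpace A] in
theorem exchange_of_not_exists {E S : Set G} {q : G → A} {σ : (E → A) → E → A} {x : G → A} {k : G}
    (h : ¬ ∃ g, g ∈ occurrences S q x ∧ g⁻¹ * k ∈ E) : exchange S q σ x k = x k := dif_neg h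

namespace IsMarker

variable {X : MulSubshift A G} {E S : Set G} {q : G → A} {C : Set (E → A)}

theorem inv_mul_mem_periods (hm : X.IsMarker E S q C) {x : G → A} {g g' k : G}
    (hg : g ∈ occurrences S q x) (hg' : g' ∈ occurrences S q x) (hk : g⁻¹ * k ∈ E)
    (hk' : g'⁻¹ * k ∈ E ∪ S) : g'⁻¹ * g ∈ X.periods := by
  by_contra ht
  refine hm.separated (fun h => x (g' * h)) (g'⁻¹ * g) hg' (fun s hs => ?_) ht _ hk ?_
  · simpa [← mul_assoc] using hg s hs
  · simpa [mul_assoc] using hk'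

theorem apply_mul_eq {x : G → A} (hx : x ∈ X.carrier) {g g' : G}
    (h : g'⁻¹ * g ∈ X.periods) (k : G) : x (g * k) = x (g' * k) := by
  simpa [← mul_assoc] using apply_mul_of_mem_periods h (X.shift_mem hx g') k

theorem restrict_mem (hm : X.IsMarker E S q C) {x : G → A} (hx : x ∈ X.carrier) {g : G}
    (hg : g ∈ occurrences S q x) : (fun e : E => x (g * e)) ∈ C := by
  refine (hm.patch_mem _ (X.shift_mem hx g) hg _).1 ?_
  convert X.shift_mem hx g using 1
  funext h
  by_cases hh : h ∈ E
  · rw [patch_of_mem _ _ hh]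
  · rw [patch_of_notMem _ _ hh]

/-- The occurrence chosen in `exchange` does not matter. Two candidates differ by a period, so they
show the same filling; the new filling, patched into a point of `X`, again gives a point of `X` and
hence respects that period. -/
theorem exchange_apply (hm : X.IsMarker E S q C) {σ : (E → A) → E → A} (hσ : Set.MapsTo σ C C)
    {x : G → A} (hx : x ∈ X.carrier) {g k : G} (hg : g ∈ occurrences S q x) (hk : g⁻¹ * k ∈ E) :
    exchange S q σ x k = σ (fun e => x (g * e)) ⟨_, hk⟩ := by
  have h : ∃ g, g ∈ occurrences S q x ∧ g⁻¹ * k ∈ E := ⟨g, hg, hk⟩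
  have e1 : exchange S q σ x k = σ (fun e => x (h.choose * e)) ⟨_, h.choose_spec.2⟩ := dif_pos h
  rw [e1]
  obtain ⟨hg', hk'⟩ := h.choose_spec
  generalize h.choose = g' at hg' hk'
  have ht := hm.inv_mul_mem_periods hg hg' hk (Or.inl hk')
  have e2 : (fun e : E => x (g' * e)) = fun e : E => x (g * e) :=
    funext fun e => (apply_mul_eq hx ht e).symm
  rw [e2]
  have hz := (hm.patch_mem _ (X.shift_mem hx g) hg _).2 (hσ (hm.restrict_mem hx hg))
  have e3 := apply_mul_of_mem_periods ht hz (g⁻¹ * k)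
  rw [patch_of_mem _ _ hk] at e3
  rw [← e3, patch_of_mem _ _ (by simpa [mul_assoc] using hk')]
  congr 2
  simp [mul_assoc]

theorem exchange_apply_mul (hm : X.IsMarker E S q C) {σ : (E → A) → E → A}
    (hσ : Set.MapsTo σ C C) {x : G → A} (hx : x ∈ X.carrier) {g : G}
    (hg : g ∈ occurrences S q x) (e : E) :
    exchange S q σ x (g * e) = σ (fun e => x (g * e)) e := by
  rw [hm.exchange_apply hσ hx hg (by simp)]
  congr
  simp

/-- A support element lying in another hole would make the two occurrences differ by a period. As
`E` is invariant under periods, it would then lie in its own hole as well, against disjointness. -/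
theorem exchange_apply_support (hm : X.IsMarker E S q C) (σ : (E → A) → E → A)
    {x : G → A} {g : G} (hg : g ∈ occurrences S q x) {s : G} (hs : s ∈ S) :
    exchange S q σ x (g * s) = x (g * s) := by
  refine exchange_of_not_exists ?_
  rintro ⟨g', hg', hk⟩
  have ht := hm.inv_mul_mem_periods hg' hg hk (Or.inr (by simpa using hs))
  exact Set.disjoint_left.1 hm.disjoint (by simpa [mul_assoc] using hm.periods_mul_mem _ ht _ hk) hs

open Classical in
-- The holes are refilled one at a time. A new occurrence either differs by a period from an earlier
-- one, and its hole is already done, or its hole and support are still untouched, so that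
-- `patch_mem` applies.
theorem exchange_finset_mem (hm : X.IsMarker E S q C) {σ : (E → A) → E → A}
    (hσ : Set.MapsTo σ C C) {x : G → A} (hx : x ∈ X.carrier) (I : Finset G)
    (hI : ∀ i ∈ I, i ∈ occurrences S q x) :
    (fun k => if ∃ i ∈ I, i⁻¹ * k ∈ E then exchange S q σ x k else x k) ∈ X.carrier := by
  induction I using Finset.induction_on with
  | empty => simpa using hx
  | insert i I _ ih =>
    have hi := hI i (Finset.mem_insert_self _ _)
    have hI' : ∀ j ∈ I, j ∈ occurrences S q x := fun j hj => hI j (Finset.mem_insert_of_mem hj)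
    specialize ih hI'
    by_cases hper : ∃ j ∈ I, j⁻¹ * i ∈ X.periods
    · obtain ⟨j, hj, ht⟩ := hper
      convert ih using 3 with k
      constructor
      · rintro ⟨i', hi', hk⟩
        rcases Finset.mem_insert.1 hi' with rfl | hi'
        · exact ⟨j, hj, by simpa [mul_assoc] using hm.periods_mul_mem _ ht _ hk⟩
        · exact ⟨i', hi', hk⟩
      · rintro ⟨i', hi', hk⟩
        exact ⟨i', Finset.mem_insert_of_mem hi', hk⟩
    · set y : G → A := fun k => if ∃ i ∈ I, i⁻¹ * k ∈ E then exchange S q σ x k else x k with hy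
      have hyx : ∀ k ∈ E ∪ S, y (i * k) = x (i * k) := fun k hk => if_neg fun ⟨j, hj, hjk⟩ =>
        hper ⟨j, hj, by
          simpa using X.periods.inv_mem
            (hm.inv_mul_mem_periods (hI' j hj) hi hjk (by simpa using hk))⟩
      have hz := (hm.patch_mem _ (X.shift_mem ih i)
        (fun s hs => (hyx s (Or.inr hs)).trans (hi s hs)) _).2 (hσ (hm.restrict_mem hx hi))
      convert X.shift_mem hz i⁻¹ using 1
      funext k
      by_cases hk : i⁻¹ * k ∈ E
      · rw [patch_of_mem _ _ hk, if_pos ⟨i, Finset.mem_insert_self _ _, hk⟩,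
          hm.exchange_apply hσ hx hi hk]
      · rw [patch_of_notMem _ _ hk, mul_inv_cancel_left]
        simp [hy, hk]

theorem exchange_mem [Finite A] [DiscreteTopology A] (hm : X.IsMarker E S q C)
    {σ : (E → A) → E → A} (hσ : Set.MapsTo σ C C) {x : G → A} (hx : x ∈ X.carrier) :
    exchange S q σ x ∈ X.carrier := by
  classical
  refine X.mem_of_forall_finset fun F => ?_
  have : ∀ k, ∃ g, (∃ g, g ∈ occurrences S q x ∧ g⁻¹ * k ∈ E) →
      g ∈ occurrences S q x ∧ g⁻¹ * k ∈ E := fun k => by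
    by_cases h : ∃ g, g ∈ occurrences S q x ∧ g⁻¹ * k ∈ E
    · exact ⟨h.choose, fun _ => h.choose_spec⟩
    · exact ⟨1, fun h' => absurd h' h⟩
  choose c hc using this
  refine ⟨_, hm.exchange_finset_mem hσ hx ((F.image c).filter (· ∈ occurrences S q x))
    (fun i hi => (Finset.mem_filter.1 hi).2), fun k hk => ?_⟩
  by_cases h : ∃ g, g ∈ occurrences S q x ∧ g⁻¹ * k ∈ E
  · exact if_pos ⟨c k, Finset.mem_filter.2 ⟨Finset.mem_image_of_mem _ hk, (hc k h).1⟩, (hc k h).2⟩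
  · rw [exchange_of_not_exists h, ite_self]

/-- Old markers survive since supports are untouched. If the support of a marker seen after the
exchange meets the hole of an old one, separation in the exchanged configuration shows that they
differ by a period; if it meets none, nothing changed there. Either way it was present before. -/
theorem occurrences_exchange (hm : X.IsMarker E S q C) (σ : (E → A) → E → A) {x : G → A}
    (hx : x ∈ X.carrier) :
    occurrences S q (exchange S q σ x) = occurrences S q x := by
  have hle : occurrences S q x ⊆ occurrences S q (exchange S q σ x) := fun g hg s hs =>
    (hm.exchange_apply_support σ hg hs).trans (hg s hs)
  refine (Set.Subset.antisymm hle fun g hg => ?_).symm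
  by_cases h : ∃ s ∈ S, ∃ g', g' ∈ occurrences S q x ∧ g'⁻¹ * (g * s) ∈ E
  · obtain ⟨s, hs, g', hg', hk⟩ := h
    have ht := hm.inv_mul_mem_periods (hle hg') hg hk (Or.inr (by simpa using hs))
    exact fun s hs => (apply_mul_eq hx ht s).symm.trans (hg' s hs)
  · push Not at h
    intro s hs
    rw [← hg s hs, exchange_of_not_exists]
    rintro ⟨g', hg', hk⟩
    exact h s hs g' hg' hk

theorem exchange_exchange [Finite A] [DiscreteTopology A] (hm : X.IsMarker E S q C)
    {σ τ : (E → A) → E → A} (hσ : Set.MapsTo σ C C) (hτ : Set.MapsTo τ C C) {x : G → A}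
    (hx : x ∈ X.carrier) : exchange S q σ (exchange S q τ x) = exchange S q (σ ∘ τ) x := by
  funext k
  have ho := hm.occurrences_exchange τ hx
  by_cases h : ∃ g, g ∈ occurrences S q x ∧ g⁻¹ * k ∈ E
  · obtain ⟨g, hg, hk⟩ := h
    rw [hm.exchange_apply hσ (hm.exchange_mem hτ hx) (ho.symm ▸ hg) hk,
      hm.exchange_apply (hσ.comp hτ) hx hg hk]
    simp only [hm.exchange_apply_mul hτ hx hg]
    rfl
  · rw [exchange_of_not_exists (by rwa [ho]), exchange_of_not_exists h, exchange_of_not_exists h]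

omit [TopologicalSpace A] in
theorem exchange_id (x : G → A) : exchange S q (id : (E → A) → E → A) x = x := by
  funext k
  by_cases h : ∃ g, g ∈ occurrences S q x ∧ g⁻¹ * k ∈ E
  · have e1 : exchange S q (id : (E → A) → E → A) x k =
      id (fun e : E => x (h.choose * e)) ⟨_, h.choose_spec.2⟩ := dif_pos h
    rw [e1]
    simp
  · exact exchange_of_not_exists h

theorem exchange_shift (hm : X.IsMarker E S q C) {σ : (E → A) → E → A}
    (hσ : Set.MapsTo σ C C) {x : G → A} (hx : x ∈ X.carrier) (a k : G) :
    exchange S q σ (fun h => x (a * h)) k = exchange S q σ x (a * k) := by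
  have ho : ∀ g, g ∈ occurrences S q (fun h => x (a * h)) ↔ a * g ∈ occurrences S q x := fun g => by
    simp [occurrences, mul_assoc]
  by_cases h : ∃ g, g ∈ occurrences S q (fun h => x (a * h)) ∧ g⁻¹ * k ∈ E
  · obtain ⟨g, hg, hk⟩ := h
    rw [hm.exchange_apply hσ (X.shift_mem hx a) hg hk,
      hm.exchange_apply hσ hx ((ho g).1 hg) (by simpa [mul_assoc] using hk)]
    simp [mul_assoc]
  · rw [exchange_of_not_exists h, exchange_of_not_exists]
    rintro ⟨g, hg, hk⟩
    exact h ⟨a⁻¹ * g, by simpa [ho] using hg, by simpa [mul_assoc] using hk⟩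

/-- The value at `k` depends only on the finitely many holes and supports `g (E ∪ S)` with `k ∈ g
E`, and on `k` itself. -/
theorem continuous_exchange [DiscreteTopology A] (hm : X.IsMarker E S q C)
    {σ : (E → A) → E → A} (hσ : Set.MapsTo σ C C) :
    Continuous fun x : X.carrier => exchange S q σ x.1 := by
  refine continuous_pi fun k => IsLocallyConstant.continuous ?_
  rw [IsLocallyConstant.iff_exists_open]
  intro x
  obtain ⟨F, hFdef⟩ : ∃ F : Set G, F = {k} * E⁻¹ * (E ∪ S) ∪ {k} := ⟨_, rfl⟩
  have hF : F.Finite := hFdef ▸ (((Set.finite_singleton k).mul hm.finite_hole.inv).mul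
    (hm.finite_hole.union hm.finite_support)).union (Set.finite_singleton k)
  have hkF : k ∈ F := hFdef ▸ Or.inr rfl
  have hgF : ∀ g, g⁻¹ * k ∈ E → ∀ s ∈ E ∪ S, g * s ∈ F := fun g hg s hs => by
    rw [hFdef]
    exact Or.inl ⟨g, ⟨k, rfl, (g⁻¹ * k)⁻¹, by simpa using hg, by simp⟩, s, hs, rfl⟩
  refine ⟨Subtype.val ⁻¹' cylinder hF.toFinset x.1,
    (isOpen_cylinder _ _).preimage continuous_subtype_val, fun _ _ => rfl, fun y hy => ?_⟩
  have hyx : ∀ g ∈ F, y.1 g = x.1 g := fun g hg => hy g (by simpa using hg)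
  have ho : ∀ g, g⁻¹ * k ∈ E → (g ∈ occurrences S q y.1 ↔ g ∈ occurrences S q x.1) :=
    fun g hg => forall₂_congr fun s hs => by rw [hyx _ (hgF g hg s (Or.inr hs))]
  by_cases h : ∃ g, g ∈ occurrences S q x.1 ∧ g⁻¹ * k ∈ E
  · obtain ⟨g, hg, hk⟩ := h
    rw [hm.exchange_apply hσ x.2 hg hk, hm.exchange_apply hσ y.2 ((ho g hk).2 hg) hk]
    congr 2
    funext e
    exact hyx _ (hgF g hk e (Or.inl e.2))
  · rw [exchange_of_not_exists h, exchange_of_not_exists, hyx k hkF]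
    rintro ⟨g, hg, hk⟩
    exact h ⟨g, (ho g hk).1 hg, hk⟩

/-- A group acting by permutations of `E → A` that preserve `C` acts on `X` by automorphisms. -/
noncomputable def exchangeHom [Finite A] [DiscreteTopology A] (hm : X.IsMarker E S q C)
    {H : Type*} [Group H] (ρ : H →* Equiv.Perm (E → A)) (hρ : ∀ h, Set.MapsTo (ρ h) C C) :
    H →* X.Aut where
  toFun h :=
    { val :=
        { toFun := fun x => ⟨exchange S q (ρ h) x.1, hm.exchange_mem (hρ h) x.2⟩
          invFun := fun x => ⟨exchange S q (ρ h⁻¹) x.1, hm.exchange_mem (hρ h⁻¹) x.2⟩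
          left_inv := fun x => Subtype.ext <| by
            dsimp only
            rw [hm.exchange_exchange (hρ _) (hρ _) x.2, ← Equiv.Perm.coe_mul, ← map_mul,
              inv_mul_cancel, map_one, Equiv.Perm.coe_one, exchange_id]
          right_inv := fun x => Subtype.ext <| by
            dsimp only
            rw [hm.exchange_exchange (hρ _) (hρ _) x.2, ← Equiv.Perm.coe_mul, ← map_mul,
              mul_inv_cancel, map_one, Equiv.Perm.coe_one, exchange_id]
          continuous_toFun := (hm.continuous_exchange (hρ h)).subtype_mk _
          continuous_invFun := (hm.continuous_exchange (hρ h⁻¹)).subtype_mk _ }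
      property := fun g x => Subtype.ext <| funext fun k => hm.exchange_shift (hρ h) x.2 g⁻¹ k }
  map_one' := Subtype.ext <| Homeomorph.ext fun x => Subtype.ext <| by
    change exchange S q (ρ 1) x.1 = x.1
    rw [map_one, Equiv.Perm.coe_one, exchange_id]
  map_mul' a b := Subtype.ext <| Homeomorph.ext fun x => Subtype.ext <| by
    change exchange S q (ρ (a * b)) x.1 = exchange S q (ρ a) (exchange S q (ρ b) x.1)
    rw [hm.exchange_exchange (hρ _) (hρ _) x.2, ← Equiv.Perm.coe_mul, ← map_mul]

/-- Each `u ∈ C` fills the hole at `1` in the point `patch E u q`; if this point is fixed, then so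
is `u`. -/
theorem exchangeHom_injective [Finite A] [DiscreteTopology A] (hm : X.IsMarker E S q C)
    (hq : q ∈ X.carrier) {H : Type*} [Group H] (ρ : H →* Equiv.Perm (E → A))
    (hρ : ∀ h, Set.MapsTo (ρ h) C C) (hinj : ∀ h, (∀ u ∈ C, ρ h u = u) → h = 1) :
    Function.Injective (hm.exchangeHom ρ hρ) := by
  rw [injective_iff_map_eq_one]
  intro h hh
  refine hinj h fun u hu => ?_
  have hx := (hm.patch_mem q hq (fun _ _ => rfl) u).2 hu
  have hocc : (1 : G) ∈ occurrences S q (patch E u q) := fun s hs => by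
    rw [one_mul, patch_of_notMem _ _ (Set.disjoint_right.1 hm.disjoint hs)]
  have e1 : exchange S q (ρ h) (patch E u q) = patch E u q :=
    congrArg (fun φ : X.Aut => (φ.1 ⟨_, hx⟩).1) hh
  have e2 : (fun e : E => patch E u q (1 * e)) = u := funext fun e => by
    rw [one_mul, patch_of_mem _ _ e.2]
  funext e
  have e3 := hm.exchange_apply_mul (hρ h) hx hocc e
  rw [e1, e2, one_mul, patch_of_mem _ _ e.2] at e3
  exact e3.symm

end IsMarker

theorem exists_isMarker [Finite A] [DiscreteTopology A] [Infinite G] (X : MulSubshift A G)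
    (hX : X.carrier.Nontrivial) (hSI : X.IsStronglyIrreducible) (n : ℕ) :
    ∃ (E S : Set G) (q : G → A) (C : Set (E → A)),
      X.IsMarker E S q C ∧ q ∈ X.carrier ∧ n ≤ C.ncard := by
  obtain ⟨K, hK⟩ := X.exists_isGluingSet hSI
  obtain ⟨E, S₀, hE, hS₀, hdisj, hper, x₀, hx₀, C, hC, hpatch⟩ := hK.exists_hole hX n
  obtain ⟨S, hS, hsub, hES, q, hq, hqx, hsep⟩ := hK.exists_marker hX hE hS₀ hdisj hx₀
  exact ⟨E, S, q, C, ⟨hE, hS, hES, hper,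
    fun y hy hyq => hpatch y hy fun s hs => (hyq (hsub hs)).trans (hqx hs), hsep⟩, hq, hC⟩

/-- A finite group acts faithfully on any finite set with at least as many elements. -/
theorem _root_.exists_perm_hom_of_card_le_ncard {H B : Type*} [Group H] [Finite H] [Finite B]
    {C : Set B} (hC : Nat.card H ≤ C.ncard) :
    ∃ ρ : H →* Equiv.Perm B, (∀ h, Set.MapsTo (ρ h) C C) ∧
      ∀ h, (∀ u ∈ C, ρ h u = u) → h = 1 := by
  classical
  obtain ⟨ι⟩ : Nonempty (H ↪ C) := by
    have := Fintype.ofFinite H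
    have := Fintype.ofFinite C
    refine Function.Embedding.nonempty_of_card_le ?_
    rwa [← Nat.card_eq_fintype_card, ← Nat.card_eq_fintype_card]
  let j : H ↪ B := ι.trans (Function.Embedding.subtype _)
  -- The left regular action of `H`, transported to the range of `j` and trivial off it.
  let ρ : H →* Equiv.Perm B := (Equiv.Perm.viaEmbeddingHom j).comp (MulAction.toPermHom H H)
  have hρ : ∀ h a, ρ h (j a) = j (h * a) := fun h a =>
    Equiv.Perm.viaEmbedding_apply _ j a
  refine ⟨ρ, fun h u hu => ?_, fun h hh => ?_⟩
  · by_cases hr : u ∈ Set.range j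
    · obtain ⟨a, rfl⟩ := hr
      rw [hρ]
      exact (ι (h * a)).2
    · rwa [show ρ h u = u from Equiv.Perm.viaEmbedding_apply_of_notMem _ j u hr]
  · have := hh (j 1) (ι 1).2
    rw [hρ, mul_one] at this
    exact j.injective this

end Exchange

end SymbolicDynamics.FullShift.MulSubshift

/-- Every finite group embeds into the automorphism group of a non-trivial (neither empty nor a
single point) strongly irreducible subshift, with finite alphabet, on an infinite group. -/
theorem mainTheorem6 {A : Type*} [Finite A] [TopologicalSpace A] [DiscreteTopology A]
    {G : Type*} [Group G] [Infinite G] (X : SymbolicDynamics.FullShift.MulSubshift A G)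
    (hX : X.carrier.Nontrivial) (hSI : X.IsStronglyIrreducible)
    (H : Type*) [Group H] [Finite H] :
    ∃ f : H →* X.Aut, Function.Injective f := by
  obtain ⟨E, S, q, C, hm, hq, hC⟩ := X.exists_isMarker hX hSI (Nat.card H)
  have : Finite E := hm.finite_hole
  obtain ⟨ρ, hρ, hinj⟩ := exists_perm_hom_of_card_le_ncard hC
  exact ⟨hm.exchangeHom ρ hρ, hm.exchangeHom_injective hq ρ hρ hinj⟩
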